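/- Let $K$ be an infinite field and let $n,r\ge 1$ be integers. Let $I(\mathbb{Z},r)=\mathbb{Z}^r$ be the set of $r$-tuples of integers and $I(n,r)=\{1,\dots,n\}^r\subset I(\mathbb{Z},r)$. The symmetric group $\Sigma_r$ acts on the right by place permutation, and the extended affine Weyl group $\widehat\Sigma_r=\Sigma_r\ltimes\mathbb{Z}^r$ acts on $I(\mathbb{Z},r)$ with $\varepsilon\in\mathbb{Z}^r$ acting by $\underline{i}\mapsto\underline{i}+n\varepsilon$, and diagonally on $I(\mathbb{Z},r)\times I(\mathbb{Z},r)$; write $\sim$ for its orbit relation on pairs. The affine Schur algebra $\widetilde S(n,r)$ is the $K$-algebra with basis elements $\xi_{\underline{i},\underline{j}}$ indexed by the $\widehat\Sigma_r$-orbits of pairs $(\underline{i},\underline{j})$, and multiplication \[ \xi_{\underline{i},\underline{j}}\,\xi_{\underline{k},\underline{l}}=\sum_{(\underline{p},\underline{q})}\#\{\underline{s}\in I(\mathbb{Z},r) : (\underline{i},\underline{j})\sim(\underline{p},\underline{s}),\ (\underline{s},\underline{q})\sim(\underline{k},\underline{l})\}\;\xi_{\underline{p},\underline{q}}, \] the sum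 being over representatives of the orbits of pairs; its identity is $\sum_{\underline{i}\in I(n,r)/\Sigma_r}\xi_{\underline{i},\underline{i}}$. For $\varepsilon\in\mathbb{Z}^r$ put \[ c_\varepsilon=\sum_{\underline{i}\in I(n,r)/\Sigma_r}\ \sum_{\sigma\in\Sigma_\varepsilon\backslash\Sigma_r/\Sigma_{\underline{i}}}\xi_{\underline{i},\,\underline{i}+n\varepsilon\sigma}, \] where $\Sigma_\varepsilon,\Sigma_{\underline{i}}$ are the stabilizers in $\Sigma_r$, and let $\varepsilon^k=(1,\dots,1,0,\dots,0)$ with $k$ ones, $1\le k\le r$. Let $\widetilde S(1\cdots1)=\xi_{1\cdots1,1\cdots1}\,\widetilde S(n,r)\,\xi_{1\cdots1,1\cdots1}$, a $K$-algebra with identity $\xi_{1\cdots1,1\cdots1}$. Let $Z$ be the center of $\widetilde S(n,r)$. Then: (a) there is an isomorphism of $K$-algebras $K[t_1,\dots,t_{r-1},t_r,t_r^{-1}]\to Z$, where $t_1,\dots,t_r$ are indeterminates, which sends $t_k$ to $c_{\varepsilon^k}$ for $1\le k\le r$ and $t_r^{-1}$ to $c_{-\varepsilon^r}$; (b) $Z=K[c_{\varepsilon^1},\dots,c_{\varepsilon^{r-1}},c_{\varepsilon^r},c_{-\varepsilon^r}]$,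 the $K$-subalgebra generated by these elements; (c) $z\mapsto z\,\xi_{1\cdots1,1\cdots1}$ is an isomorphism of $K$-algebras from $Z$ onto $\widetilde S(1\cdots1)$; (d) $\widetilde S(n,r)$ is indecomposable: it is nonzero and is not the direct sum of two nonzero two-sided ideals. -/

import Mathlib

universe u

namespace AffineSchur

open Equiv

/-- `I(ℤ, r)`: all `r`-tuples of integers. -/
abbrev ZTuple (r : ℕ) : Type := Fin r → ℤ

/-- The right action on `I(ℤ, r)` of the element `(σ, μ)` of the extended affine Weyl group
`Σ_r ⋉ ℤ^r`: the place permutation `σ` followed by the shift by `n μ`, that is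
`i ↦ i σ + n μ`, where `(i σ)_t = i_{σ(t)}`. -/
def act (n : ℕ) {r : ℕ} (σ : Perm (Fin r)) (μ : Fin r → ℤ) (i : ZTuple r) : ZTuple r :=
  fun t => i (σ t) + (n : ℤ) * μ t

/-- The orbit equivalence relation of the diagonal action of the extended affine Weyl group
on `I(ℤ, r) × I(ℤ, r)`. -/
def pairSetoid (n r : ℕ) : Setoid (ZTuple r × ZTuple r) where
  r x y := ∃ (σ : Perm (Fin r)) (μ : Fin r → ℤ), act n σ μ x.1 = y.1 ∧ act n σ μ x.2 = y.2
  iseqv :=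
    { refl := fun x => ⟨1, 0, by ext; simp [act], by ext; simp [act]⟩
      symm := by
        rintro x y ⟨σ, μ, h1, h2⟩
        refine ⟨σ⁻¹, fun t => - μ (σ⁻¹ t), ?_, ?_⟩
        · ext t; rw [← h1]; simp [act]
        · ext t; rw [← h2]; simp [act]
      trans := by
        rintro x y z ⟨σ, μ, h1, h2⟩ ⟨τ, ν, h3, h4⟩
        refine ⟨σ * τ, fun t => μ (τ t) + ν t, ?_, ?_⟩
        · ext t; rw [← h3, ← h1]; simp [act]; ring
        · ext t; rw [← h4, ← h2]; simp [act]; ring }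

/-- The set of orbits of the extended affine Weyl group on `I(ℤ, r) × I(ℤ, r)`; it indexes the
standard basis of the affine Schur algebra. -/
def PairOrbit (n r : ℕ) : Type := Quotient (pairSetoid n r)

/-- The orbit of the pair `(i, j)`. -/
def orb (n : ℕ) {r : ℕ} (i j : ZTuple r) : PairOrbit n r :=
  Quotient.mk (pairSetoid n r) (i, j)

theorem orb_eq_iff {n r : ℕ} {i j k l : ZTuple r} :
    orb n i j = orb n k l ↔ ∃ (σ : Perm (Fin r)) (μ : Fin r → ℤ),
      act n σ μ i = k ∧ act n σ μ j = l :=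
  Quotient.eq (r := pairSetoid n r)

theorem exists_orb {n r : ℕ} (C : PairOrbit n r) : ∃ i j, C = orb n i j := by
  induction C using Quotient.inductionOn with
  | h x => exact ⟨x.1, x.2, rfl⟩

/-- `act` as a bijection. -/
def actEquiv (n : ℕ) {r : ℕ} (σ : Perm (Fin r)) (μ : Fin r → ℤ) : ZTuple r ≃ ZTuple r where
  toFun := act n σ μ
  invFun := act n σ⁻¹ (fun t => - μ (σ⁻¹ t))
  left_inv i := by ext t; simp [act]
  right_inv i := by ext t; simp [act]

theorem orb_act {n r : ℕ} (σ : Perm (Fin r)) (μ : Fin r → ℤ) (i j : ZTuple r) :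
    orb n (act n σ μ i) (act n σ μ j) = orb n i j :=
  (orb_eq_iff.2 ⟨σ, μ, rfl, rfl⟩).symm

/-- The structure constant of the affine Schur algebra: for the orbits `A` of `(i, j)`, `B` of
`(k, l)` and `C` of `(p, q)`, the number of `s ∈ I(ℤ, r)` with `(i, j) ∼ (p, s)` and
`(s, q) ∼ (k, l)`. -/
noncomputable def structConst {n r : ℕ} (A B C : PairOrbit n r) : ℕ :=
  Quotient.lift
    (fun x : ZTuple r × ZTuple r =>
      Nat.card {s : ZTuple r // orb n x.1 s = A ∧ orb n s x.2 = B})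
    (by
      rintro x y ⟨σ, μ, h1, h2⟩
      refine Nat.card_congr ((actEquiv n σ μ).subtypeEquiv fun s => ?_)
      rw [← h1, ← h2]
      simp only [actEquiv, Equiv.coe_fn_mk, orb_act]) C

theorem finite_right {n r : ℕ} (A : PairOrbit n r) (p : ZTuple r) :
    {s : ZTuple r | orb n p s = A}.Finite := by
  obtain ⟨i, j, rfl⟩ := exists_orb A
  refine (Set.finite_range
    (fun σ : Perm (Fin r) => fun t => j (σ t) + (p t - i (σ t)))).subset ?_
  intro s hs
  obtain ⟨σ, μ, h1, h2⟩ := orb_eq_iff.1 (Eq.symm hs)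
  refine ⟨σ, ?_⟩
  ext t
  rw [← h1, ← h2]
  simp [act]

theorem finite_left {n r : ℕ} (A : PairOrbit n r) (q : ZTuple r) :
    {s : ZTuple r | orb n s q = A}.Finite := by
  obtain ⟨i, j, rfl⟩ := exists_orb A
  refine (Set.finite_range
    (fun σ : Perm (Fin r) => fun t => i (σ t) + (q t - j (σ t)))).subset ?_
  intro s hs
  obtain ⟨σ, μ, h1, h2⟩ := orb_eq_iff.1 (Eq.symm hs)
  refine ⟨σ, ?_⟩
  ext t
  rw [← h1, ← h2]
  simp [act]

theorem structConst_finite {n r : ℕ} (A B : PairOrbit n r) :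
    {C : PairOrbit n r | structConst A B C ≠ 0}.Finite := by
  obtain ⟨i, j, rfl⟩ := exists_orb A
  refine (((finite_right (orb n i j) i).biUnion fun s _ => finite_right B s).image
    (fun q => orb n i q)).subset ?_
  intro C hC
  obtain ⟨p, q, rfl⟩ := exists_orb C
  have hne : Nonempty {s : ZTuple r // orb n p s = orb n i j ∧ orb n s q = B} := by
    by_contra h
    rw [not_nonempty_iff] at h
    exact hC (Nat.card_of_isEmpty)
  obtain ⟨s, h1, h2⟩ := hne
  obtain ⟨σ, μ, h3, h4⟩ := orb_eq_iff.1 h1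
  refine ⟨act n σ μ q, ?_, ?_⟩
  · simp only [Set.mem_iUnion, Set.mem_ofPred_eq]
    refine ⟨act n σ μ s, ?_, ?_⟩
    · rw [← h1, ← orb_act σ μ p s, h3]
    · rw [orb_act, h2]
  · change orb n i (act n σ μ q) = _
    rw [← h3, orb_act]

/-- The affine Schur algebra `S̃(n, r)` over `K`: the `K`-vector space with basis indexed by the
orbits of the extended affine Weyl group on `I(ℤ, r) × I(ℤ, r)`. -/
def Alg (K : Type u) [Field K] (n r : ℕ) : Type u := PairOrbit n r →₀ K

variable {K : Type u} [Field K] {n r : ℕ}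

noncomputable instance : AddCommGroup (Alg K n r) :=
  inferInstanceAs (AddCommGroup (PairOrbit n r →₀ K))

noncomputable instance : Module K (Alg K n r) :=
  inferInstanceAs (Module K (PairOrbit n r →₀ K))

variable (K n) in
/-- The basis element `ξ_{i, j}`, which depends only on the orbit of `(i, j)`. -/
noncomputable def xi (i j : ZTuple r) : Alg K n r :=
  (Finsupp.single (orb n i j) 1 : PairOrbit n r →₀ K)

variable (K) in
/-- The product of two basis elements: `∑_C structConst A B C · ξ_C`. -/
noncomputable def basisMul (A B : PairOrbit n r) : Alg K n r :=
  (Finsupp.ofSupportFinite (fun C => (structConst A B C : K))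
    ((structConst_finite A B).subset fun C hC h => hC (by simp [h])) : PairOrbit n r →₀ K)

variable (K n r) in
/-- The bilinear extension of `basisMul`. -/
noncomputable def mulHom : Alg K n r →ₗ[K] Alg K n r →ₗ[K] Alg K n r :=
  (Finsupp.linearCombination K fun A : PairOrbit n r =>
    (Finsupp.linearCombination K fun B : PairOrbit n r => basisMul K A B :
      (PairOrbit n r →₀ K) →ₗ[K] Alg K n r) :
    (PairOrbit n r →₀ K) →ₗ[K] ((PairOrbit n r →₀ K) →ₗ[K] Alg K n r))

noncomputable instance : Mul (Alg K n r) := ⟨fun f g => mulHom K n r f g⟩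

/-- The coefficient of `f` at the orbit of `(p, q)`. -/
noncomputable def coeff (f : Alg K n r) (p q : ZTuple r) : K :=
  DFunLike.coe (F := PairOrbit n r →₀ K) f (orb n p q)

theorem ext_coeff {f g : Alg K n r} (h : ∀ p q, coeff f p q = coeff g p q) : f = g := by
  refine Finsupp.ext (M := K) fun C => ?_
  obtain ⟨p, q, rfl⟩ := exists_orb C
  exact h p q

theorem coeff_add (f g : Alg K n r) (p q : ZTuple r) :
    coeff (f + g) p q = coeff f p q + coeff g p q := rfl

theorem coeff_zero (p q : ZTuple r) : coeff (0 : Alg K n r) p q = 0 := rfl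

theorem coeff_smul (a : K) (f : Alg K n r) (p q : ZTuple r) :
    coeff (a • f) p q = a * coeff f p q := rfl

theorem coeff_sum {ι : Type*} (s : Finset ι) (f : ι → Alg K n r) (p q : ZTuple r) :
    coeff (∑ x ∈ s, f x) p q = ∑ x ∈ s, coeff (f x) p q :=
  map_sum (⟨⟨fun f : Alg K n r => coeff f p q, coeff_zero p q⟩,
    fun f g => coeff_add f g p q⟩ : Alg K n r →+ K) f s

open Classical in
theorem coeff_xi (i j p q : ZTuple r) :
    coeff (xi K n i j) p q = if orb n i j = orb n p q then 1 else 0 :=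
  Finsupp.single_apply

theorem coeff_finite_right (f : Alg K n r) (p : ZTuple r) :
    {s | coeff f p s ≠ 0}.Finite := by
  refine ((Finsupp.hasFiniteSupport (M := K) f).biUnion fun A _ => finite_right A p).subset ?_
  intro s hs
  simp only [Set.mem_iUnion]
  exact ⟨orb n p s, hs, rfl⟩

theorem coeff_finite_left (f : Alg K n r) (q : ZTuple r) :
    {s | coeff f s q ≠ 0}.Finite := by
  refine ((Finsupp.hasFiniteSupport (M := K) f).biUnion fun A _ => finite_left A q).subset ?_
  intro s hs
  simp only [Set.mem_iUnion]
  exact ⟨orb n s q, hs, rfl⟩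

theorem induction_xi {P : Alg K n r → Prop} (f : Alg K n r) (h0 : P 0)
    (hadd : ∀ f g, P f → P g → P (f + g)) (hsmul : ∀ (a : K) i j, P (a • xi K n i j)) : P f := by
  refine Finsupp.induction_linear (M := K) f h0 hadd fun A a => ?_
  obtain ⟨i, j, rfl⟩ := exists_orb A
  have h := hsmul a i j
  unfold xi at h
  erw [Finsupp.smul_single] at h
  simpa using h

theorem mul_def (f g : Alg K n r) : f * g = mulHom K n r f g := rfl

theorem xi_mul_xi (i j k l : ZTuple r) :
    xi K n i j * xi K n k l = basisMul K (orb n i j) (orb n k l) := by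
  have h1 : mulHom K n r (xi K n i j) =
      (Finsupp.linearCombination K fun B : PairOrbit n r => basisMul K (orb n i j) B) := by
    exact (Finsupp.linearCombination_single (M := (PairOrbit n r →₀ K) →ₗ[K] Alg K n r)
      K (1 : K) (orb n i j)).trans (one_smul K _)
  rw [mul_def, h1]
  exact (Finsupp.linearCombination_single K (1 : K) (orb n k l)).trans (one_smul _ _)

theorem coeff_basisMul (A B : PairOrbit n r) (p q : ZTuple r) :
    coeff (basisMul K A B) p q =
      (Nat.card {s : ZTuple r // orb n p s = A ∧ orb n s q = B} : K) := rfl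

/-- Multiplication is convolution of invariant functions on `I(ℤ, r) × I(ℤ, r)`. -/
theorem coeff_mul (f g : Alg K n r) (p q : ZTuple r) :
    coeff (f * g) p q = ∑ᶠ s, coeff f p s * coeff g s q := by
  have fin : ∀ f g : Alg K n r,
      (Function.support fun s => coeff f p s * coeff g s q).Finite := fun f g =>
    (coeff_finite_right f p).subset fun s hs h => hs (by simp [h])
  induction f using induction_xi with
  | h0 => simp [mul_def, coeff_zero]
  | hadd f₁ f₂ h₁ h₂ =>
    rw [mul_def, map_add, LinearMap.add_apply, coeff_add, ← mul_def, ← mul_def, h₁, h₂,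
      ← finsum_add_distrib (fin _ _) (fin _ _)]
    simp only [coeff_add, add_mul]
  | hsmul a i j =>
    induction g using induction_xi with
    | h0 => simp [mul_def, coeff_zero]
    | hadd g₁ g₂ h₁ h₂ =>
      rw [mul_def, map_add, coeff_add, ← mul_def, ← mul_def, h₁, h₂,
        ← finsum_add_distrib (fin _ _) (fin _ _)]
      simp only [coeff_add, mul_add]
    | hsmul b k l =>
      classical
      rw [mul_def, map_smul, LinearMap.map_smul, LinearMap.smul_apply, ← mul_def, xi_mul_xi,
        coeff_smul, coeff_smul, coeff_basisMul]
      have hfin : {s : ZTuple r | orb n p s = orb n i j ∧ orb n s q = orb n k l}.Finite :=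
        (finite_right (orb n i j) p).subset fun s hs => hs.1
      have hterm : ∀ s, coeff (a • xi K n i j) p s * coeff (b • xi K n k l) s q =
          if s ∈ hfin.toFinset then b * a else 0 := by
        intro s
        simp only [coeff_smul, coeff_xi, Set.Finite.mem_toFinset, Set.mem_ofPred_eq,
          eq_comm (a := orb n p s), eq_comm (a := orb n s q)]
        by_cases h1 : orb n i j = orb n p s <;> by_cases h2 : orb n k l = orb n s q <;>
          simp [h1, h2, mul_comm]
      simp only [hterm]
      rw [finsum_eq_sum_of_support_subset (s := hfin.toFinset)]
      · rw [Finset.sum_congr rfl (fun s hs => if_pos hs), Finset.sum_const, nsmul_eq_mul]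
        have : Nat.card {s : ZTuple r // orb n p s = orb n i j ∧ orb n s q = orb n k l} =
            hfin.toFinset.card := by
          rw [← Set.ncard_eq_toFinset_card _ hfin]; rfl
        rw [this]; ring
      · intro s hs
        by_contra h
        exact hs (if_neg h)

/-- `I(n, r)`: the `r`-tuples with entries in an `n`-element set. -/
abbrev NTuple (n r : ℕ) : Type := Fin r → Fin n

/-- The inclusion of `I(n, r)` into `I(ℤ, r)`, with entries in `{1, …, n}`. -/
def NTuple.toZ (i : NTuple n r) : ZTuple r := fun t => ((i t : ℕ) : ℤ) + 1

/-- The orbit relation of the place permutation action of `Σ_r` on `I(n, r)`. -/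
def tupleSetoid (n r : ℕ) : Setoid (NTuple n r) where
  r i j := ∃ σ : Perm (Fin r), i ∘ σ = j
  iseqv :=
    { refl := fun i => ⟨1, rfl⟩
      symm := by
        rintro i j ⟨σ, rfl⟩
        exact ⟨σ⁻¹, by ext; simp⟩
      trans := by
        rintro i j k ⟨σ, rfl⟩ ⟨τ, rfl⟩
        exact ⟨σ * τ, rfl⟩ }

/-- `I(n, r) / Σ_r`. -/
def TupleClass (n r : ℕ) : Type := Quotient (tupleSetoid n r)

noncomputable instance : Fintype (TupleClass n r) :=
  @Fintype.ofFinite _ (Quotient.finite (tupleSetoid n r))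

/-- A chosen representative in `I(n, r)` of a class in `I(n, r) / Σ_r`. -/
noncomputable def TupleClass.rep (I : TupleClass n r) : NTuple n r := Quotient.out I

/-- The identity element is `∑ ξ_{i, i}`, the sum over representatives `i` of
`I(n, r) / Σ_r`. -/
noncomputable instance : One (Alg K n r) :=
  ⟨∑ I : TupleClass n r, xi K n I.rep.toZ I.rep.toZ⟩

theorem one_def : (1 : Alg K n r) = ∑ I : TupleClass n r, xi K n I.rep.toZ I.rep.toZ := rfl

theorem orb_self_eq_iff {i p q : ZTuple r} (h : orb n i i = orb n p q) : p = q := by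
  obtain ⟨σ, μ, h1, h2⟩ := orb_eq_iff.1 h
  rw [← h1, ← h2]

theorem exists_rep [NeZero n] (p : ZTuple r) :
    ∃ I : TupleClass n r, orb n I.rep.toZ I.rep.toZ = orb n p p := by
  have hn : (0 : ℤ) < n := by exact_mod_cast Nat.pos_of_ne_zero (NeZero.ne n)
  have hnn : ∀ t, 0 ≤ (p t - 1) % (n : ℤ) := fun t => Int.emod_nonneg _ hn.ne'
  have hlt : ∀ t, (p t - 1) % (n : ℤ) < n := fun t => Int.emod_lt_of_pos _ hn
  let i : NTuple n r := fun t => ⟨((p t - 1) % (n : ℤ)).toNat, by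
    have := hnn t; have := hlt t; omega⟩
  have hI : ∃ σ : Perm (Fin r), (TupleClass.rep (Quotient.mk (tupleSetoid n r) i)) ∘ σ = i :=
    Quotient.exact (Quotient.out_eq (Quotient.mk (tupleSetoid n r) i))
  obtain ⟨σ, hσ⟩ := hI
  refine ⟨Quotient.mk (tupleSetoid n r) i, ?_⟩
  have key : act n σ (fun t => (p t - 1) / (n : ℤ))
      (NTuple.toZ (TupleClass.rep (Quotient.mk (tupleSetoid n r) i))) = p := by
    ext t
    have h1 : (TupleClass.rep (Quotient.mk (tupleSetoid n r) i)) (σ t) = i t := congrFun hσ t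
    have h2 : (((i t : Fin n) : ℕ) : ℤ) = (p t - 1) % (n : ℤ) := Int.toNat_of_nonneg (hnn t)
    have h3 := Int.emod_add_mul_ediv (p t - 1) (n : ℤ)
    simp only [act, NTuple.toZ, h1, h2]
    linarith
  exact orb_eq_iff.2 ⟨σ, _, key, key⟩

theorem rep_unique {I J : TupleClass n r}
    (h : orb n I.rep.toZ I.rep.toZ = orb n J.rep.toZ J.rep.toZ) : I = J := by
  obtain ⟨σ, μ, h1, -⟩ := orb_eq_iff.1 h
  have hIJ : I.rep ∘ σ = J.rep := by
    ext t
    have h2 := congrFun h1 t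
    simp only [act, NTuple.toZ] at h2
    have a1 := (I.rep (σ t)).isLt
    have a2 := (J.rep t).isLt
    have h3 : (((I.rep (σ t) : Fin n) : ℕ) : ℤ) % n = (((J.rep t : Fin n) : ℕ) : ℤ) % n := by
      have : (((J.rep t : Fin n) : ℕ) : ℤ) = ((I.rep (σ t) : Fin n) : ℕ) + (n : ℤ) * μ t := by
        linarith
      rw [this, Int.add_mul_emod_self_left]
    rw [Int.emod_eq_of_lt (by positivity) (by exact_mod_cast a1),
      Int.emod_eq_of_lt (by positivity) (by exact_mod_cast a2)] at h3
    exact_mod_cast h3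
  have h4 : (tupleSetoid n r) I.rep J.rep := ⟨σ, hIJ⟩
  have h5 := Quotient.sound h4
  exact (Quotient.out_eq I).symm.trans (h5.trans (Quotient.out_eq J))

open Classical in
theorem coeff_one [NeZero n] (p q : ZTuple r) :
    coeff (1 : Alg K n r) p q = if p = q then 1 else 0 := by
  rw [one_def, coeff_sum]
  simp only [coeff_xi]
  split_ifs with h
  · subst h
    obtain ⟨I, hI⟩ := exists_rep (n := n) p
    rw [Finset.sum_eq_single I, if_pos hI]
    · intro J _ hJ
      exact if_neg fun h => hJ (rep_unique (h.trans hI.symm))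
    · simp
  · exact Finset.sum_eq_zero fun I _ => if_neg fun h' => h (orb_self_eq_iff h')

protected theorem mul_assoc' (f g h : Alg K n r) : f * g * h = f * (g * h) := by
  refine ext_coeff fun p q => ?_
  rw [coeff_mul, coeff_mul]
  simp only [coeff_mul]
  let U := (coeff_finite_right f p).toFinset
  let V := (coeff_finite_left h q).toFinset
  have hU : ∀ u, u ∉ U → coeff f p u = 0 := fun u hu => by simpa [U] using hu
  have hV : ∀ s, s ∉ V → coeff h s q = 0 := fun u hu => by simpa [V] using hu
  have e1 : ∀ s, ∑ᶠ u, coeff f p u * coeff g u s = ∑ u ∈ U, coeff f p u * coeff g u s :=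
    fun s => finsum_eq_sum_of_support_subset _ fun u hu => by
      by_contra hc; exact hu (by simp [hU u hc])
  have e2 : ∀ u, ∑ᶠ s, coeff g u s * coeff h s q = ∑ s ∈ V, coeff g u s * coeff h s q :=
    fun s => finsum_eq_sum_of_support_subset _ fun u hu => by
      by_contra hc; exact hu (by simp [hV u hc])
  simp only [e1, e2]
  rw [finsum_eq_sum_of_support_subset (s := V) _ fun s hs => by
      by_contra hc; exact hs (by simp [hV s hc]),
    finsum_eq_sum_of_support_subset (s := U) _ fun s hs => by
      by_contra hc; exact hs (by simp [hU s hc])]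
  simp only [Finset.sum_mul, Finset.mul_sum]
  rw [Finset.sum_comm]
  simp only [mul_assoc]

protected theorem one_mul' [NeZero n] (f : Alg K n r) : 1 * f = f := by
  classical
  refine ext_coeff fun p q => ?_
  rw [coeff_mul, finsum_eq_single _ p fun s hs => by simp [coeff_one, hs.symm]]
  simp [coeff_one]

protected theorem mul_one' [NeZero n] (f : Alg K n r) : f * 1 = f := by
  classical
  refine ext_coeff fun p q => ?_
  rw [coeff_mul, finsum_eq_single _ q fun s hs => by simp [coeff_one, hs]]
  simp [coeff_one]

noncomputable instance [NeZero n] : Ring (Alg K n r) :=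
  { (inferInstance : AddCommGroup (Alg K n r)), (inferInstance : Mul (Alg K n r)),
    (inferInstance : One (Alg K n r)) with
    left_distrib := fun f g h => (mulHom K n r f).map_add g h
    right_distrib := fun f g h => by simp only [mul_def, map_add, LinearMap.add_apply]
    zero_mul := fun f => by simp [mul_def]
    mul_zero := fun f => by simp [mul_def]
    mul_assoc := AffineSchur.mul_assoc'
    one_mul := AffineSchur.one_mul'
    mul_one := AffineSchur.mul_one' }

noncomputable instance [NeZero n] : Algebra K (Alg K n r) :=
  Algebra.ofModule (fun a f g => by simp [mul_def]) (fun a f g => by simp [mul_def])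

/-- The elements `ξ_{i, i}` are idempotent. -/
theorem xi_self_idem [NeZero n] (i : ZTuple r) : IsIdempotentElem (xi K n i i) := by
  classical
  refine ext_coeff fun p q => ?_
  rw [coeff_mul, finsum_eq_single _ p fun s hs => by
    have : coeff (xi K n i i) p s = 0 := by
      rw [coeff_xi, if_neg fun h => hs (orb_self_eq_iff h).symm]
    rw [this, zero_mul]]
  by_cases h : orb n i i = orb n p q
  · obtain rfl := orb_self_eq_iff h
    simp [coeff_xi, h]
  · simp [coeff_xi, h]

variable (K n) in
/-- The centralizer algebra `S̃(i) = ξ_{i, i} S̃(n, r) ξ_{i, i}`, with identity `ξ_{i, i}`. -/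
abbrev CentralizerAlg [NeZero n] (i : ZTuple r) : Type u :=
  (xi_self_idem (K := K) (n := n) i).Corner

noncomputable instance [NeZero n] (i : ZTuple r) : SMul K (CentralizerAlg K n i) :=
  ⟨fun a x => ⟨a • x.1, by
    obtain ⟨y, hy⟩ := x.2
    exact ⟨a • y, by rw [← hy]; simp⟩⟩⟩

/-- Scalars of `K` act on the centralizer algebra as they act on `S̃(n, r)`. -/
noncomputable instance [NeZero n] (i : ZTuple r) : Module K (CentralizerAlg K n i) where
  one_smul x := Subtype.ext (one_smul K x.1)
  mul_smul a b x := Subtype.ext (mul_smul a b x.1)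
  smul_zero a := Subtype.ext (smul_zero a)
  smul_add a x y := Subtype.ext (smul_add a x.1 y.1)
  add_smul a b x := Subtype.ext (add_smul a b x.1)
  zero_smul x := Subtype.ext (zero_smul K x.1)

noncomputable instance [NeZero n] (i : ZTuple r) : Algebra K (CentralizerAlg K n i) :=
  Algebra.ofModule (fun a x y => Subtype.ext (smul_mul_assoc a x.1 y.1))
    (fun a x y => Subtype.ext (mul_smul_comm a x.1 y.1))

/-- The stabilizer in `Σ_r` of a tuple under place permutation. -/
def stab {S : Type*} (i : Fin r → S) : Subgroup (Perm (Fin r)) where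
  carrier := {σ | i ∘ σ = i}
  mul_mem' := by
    intro σ τ hσ hτ
    change (i ∘ σ) ∘ τ = i
    have h1 : i ∘ σ = i := hσ
    have h2 : i ∘ τ = i := hτ
    rw [h1, h2]
  one_mem' := rfl
  inv_mem' := by
    intro σ hσ
    have h : i ∘ σ = i := hσ
    change i ∘ ⇑σ⁻¹ = i
    nth_rewrite 1 [← h]
    ext; simp

/-- The double cosets `Σ_ε \ Σ_r / Σ_i`. -/
abbrev StabCosets (ε : Fin r → ℤ) (i : NTuple n r) : Type :=
  DoubleCoset.Quotient (stab ε : Set (Perm (Fin r))) (stab i : Set (Perm (Fin r)))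

noncomputable instance (ε : Fin r → ℤ) (i : NTuple n r) : Fintype (StabCosets ε i) :=
  @Fintype.ofFinite _ (Quotient.finite _)

variable (K n) in
/-- `c_ε = ∑_i ∑_σ ξ_{i, i + n ε σ}`, where `i` runs over representatives of `I(n, r) / Σ_r` and
`σ` over representatives of `Σ_ε \ Σ_r / Σ_i`. -/
noncomputable def c (ε : Fin r → ℤ) : Alg K n r :=
  ∑ I : TupleClass n r, ∑ d : StabCosets ε I.rep,
    xi K n I.rep.toZ (fun t => I.rep.toZ t + (n : ℤ) * ε (Quotient.out d t))

/-- `ε^k = (1, …, 1, 0, …, 0)` with `k` ones. -/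
def eps (r k : ℕ) : Fin r → ℤ := fun t => if (t : ℕ) < k then 1 else 0

/-- A ring is indecomposable if it is nonzero and not the direct sum of two nonzero two-sided
ideals. -/
def IsIndecomposableRing (A : Type*) [Ring A] : Prop :=
  Nontrivial A ∧ ∀ I J : TwoSidedIdeal A, IsCompl I J → I = ⊥ ∨ J = ⊥

variable (K) in
/-- The ring `K[t_1, …, t_{r-1}, t_r, t_r⁻¹]`: the polynomial ring in `t_1, …, t_r` (the variable
`t_{k+1}` is `X k`) with `t_r` inverted. -/
abbrev PolyLaurent (r : ℕ) [NeZero r] : Type u :=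
  Localization.Away (MvPolynomial.X (Fin.rev 0) : MvPolynomial (Fin r) K)

end AffineSchur

namespace AffineSchur

open Equiv MvPolynomial

variable {K : Type u} [Field K] {n r : ℕ}

/-! By `coeff_mul`, the algebra is the convolution algebra of invariant functions `f(a, b)` on pairs
of tuples. A symmetric polynomial `p` gives such a function: its value at `(a, a + n m)` is the
coefficient of `m` in `p`, and it vanishes at all other pairs. Symmetry of `p` gives invariance
under permutations, and dependence on `b - a` alone gives invariance under translations. The
resulting map `ofSymm` is an injective algebra homomorphism with central image
(`ofSymm_mem_center`), and it sends the `k`-th elementary symmetric polynomial to `c_{ε^k}`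
(`ofSymm_esymm`). Here `c_{ε^r}` is translation by `(n, …, n)`, hence a central unit with inverse
`c_{-ε^r}`.

That nothing else is central follows by comparison with the corner at `ξ = ξ_{1⋯1, 1⋯1}`. The orbit
of the constant tuple is the lattice `1 + nℤ^r`, so a corner element is a symmetric Laurent
polynomial. A power of `c_{ε^r}` clears the negative exponents, so the corner lies in `Z ξ`
(`exists_mul_pow_eq_ofSymm_mul`). Conversely, the left module generated by `ξ` is faithful
(`eq_zero_of_forall_mul_xi_one`), so `z ↦ z ξ` is injective on `Z`. Hence `Z`, the corner and the
symmetric Laurent polynomials agree. The fundamental theorem of symmetric polynomials turns the last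
into `K[t_1, …, t_r, t_r⁻¹]`. This is a domain, so there are no nontrivial central idempotents, and
the algebra is indecomposable. -/

/-! ### Orbits of pairs and diagonal idempotents -/

theorem orb_translate (μ : Fin r → ℤ) (i j : ZTuple r) :
    orb n (i + (n : ℤ) • μ) (j + (n : ℤ) • μ) = orb n i j := by
  refine (orb_eq_iff.2 ⟨1, μ, ?_, ?_⟩).symm <;> ext t <;> simp [act]

theorem orb_comp_perm (σ : Perm (Fin r)) (i j : ZTuple r) :
    orb n (i ∘ σ) (j ∘ σ) = orb n i j := by
  refine (orb_eq_iff.2 ⟨σ, 0, ?_, ?_⟩).symm <;> ext t <;> simp [act]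

theorem coeff_congr {i j k l : ZTuple r} (f : Alg K n r) (h : orb n i j = orb n k l) :
    coeff f i j = coeff f k l := by
  unfold coeff; rw [h]

theorem orb_diag {i j p q : ZTuple r} (h : orb n i j = orb n p q) :
    orb n i i = orb n p p ∧ orb n j j = orb n q q := by
  obtain ⟨σ, μ, h1, h2⟩ := orb_eq_iff.1 h
  exact ⟨orb_eq_iff.2 ⟨σ, μ, h1, h1⟩, orb_eq_iff.2 ⟨σ, μ, h2, h2⟩⟩

open Classical in
theorem coeff_mul_xi_self (f : Alg K n r) (i p q : ZTuple r) :
    coeff (f * xi K n i i) p q = if orb n i i = orb n q q then coeff f p q else 0 := by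
  rw [coeff_mul, finsum_eq_single _ q fun s hs => by
    rw [coeff_xi, if_neg fun h => hs (orb_self_eq_iff h), mul_zero]]
  rw [coeff_xi]; split_ifs <;> simp

open Classical in
theorem coeff_xi_self_mul (f : Alg K n r) (i p q : ZTuple r) :
    coeff (xi K n i i * f) p q = if orb n i i = orb n p p then coeff f p q else 0 := by
  rw [coeff_mul, finsum_eq_single _ p fun s hs => by
    rw [coeff_xi, if_neg fun h => hs (orb_self_eq_iff h).symm, zero_mul]]
  rw [coeff_xi]; split_ifs <;> simp

/-- Place permutations fix the constant tuple, so only translations move it. This is why the corner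
at `1⋯1` is governed by the lattice `ℤ^r`. -/
theorem orb_one_eq_iff {q : ZTuple r} :
    orb n (1 : ZTuple r) 1 = orb n q q ↔ ∃ μ : Fin r → ℤ, q = 1 + (n : ℤ) • μ := by
  constructor
  · intro h
    obtain ⟨σ, μ, h1, -⟩ := orb_eq_iff.1 h
    exact ⟨μ, by rw [← h1]; ext t; simp [act]⟩
  · rintro ⟨μ, rfl⟩
    exact (orb_translate μ 1 1).symm

/-- The left module `S̃(n, r) ξ_{1⋯1, 1⋯1}` is faithful. -/
theorem eq_zero_of_forall_mul_xi_one [NeZero n] (x : Alg K n r)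
    (h : ∀ y, x * y * xi K n (1 : ZTuple r) 1 = 0) : x = 0 := by
  classical
  refine ext_coeff fun p s => ?_
  by_contra hne
  rw [coeff_zero] at hne
  have hn : (0 : ℤ) < n := by exact_mod_cast Nat.pos_of_ne_zero (NeZero.ne n)
  -- Row `p` of `x` has finite support, so one bound serves for all entries of all its tuples.
  obtain ⟨M, hM⟩ : ∃ M : ℤ, ∀ s', coeff x p s' ≠ 0 → ∀ t, |s' t| ≤ M := by
    refine ⟨∑ s' ∈ (coeff_finite_right x p).toFinset, ∑ t, |s' t|, fun s' hs' t => ?_⟩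
    calc |s' t| ≤ ∑ t, |s' t| :=
          Finset.single_le_sum (f := fun t => |s' t|) (fun _ _ => abs_nonneg _)
            (Finset.mem_univ t)
      _ ≤ _ := Finset.single_le_sum (f := fun s' : ZTuple r => ∑ t, |s' t|)
            (fun _ _ => Finset.sum_nonneg fun _ _ => abs_nonneg _) (by simpa using hs')
  -- Entries of `u` are at least `2M + 1` apart, while entries of tuples in the support differ by at
  -- most `2M`. So `(s, u) ∼ (s', u)` forces the permutation to be trivial and `s' = s`, and the
  -- entry of `x ξ_{s,u}` at `(p, u)` is exactly that of `x` at `(p, s)`.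
  let u : ZTuple r := 1 + (n : ℤ) • fun t : Fin r => (2 * M + 1) * ((t : ℕ) : ℤ)
  have hu : orb n (1 : ZTuple r) 1 = orb n u u := orb_one_eq_iff.2 ⟨_, rfl⟩
  have h0 : coeff (x * xi K n s u * xi K n (1 : ZTuple r) 1) p u = 0 := by rw [h]; rfl
  rw [coeff_mul_xi_self, if_pos hu, coeff_mul, finsum_eq_single _ s] at h0
  · rw [coeff_xi, if_pos rfl, mul_one] at h0
    exact hne h0
  · intro s' hs'
    by_cases hx : coeff x p s' = 0
    · rw [hx, zero_mul]
    rw [coeff_xi, if_neg, mul_zero]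
    intro ho
    obtain ⟨σ, μ, h1, h2⟩ := orb_eq_iff.1 ho
    refine hs' (funext fun t => ?_)
    have e1 := congrFun h1 t
    have e2 := congrFun h2 t
    simp only [act, u, Pi.add_apply, Pi.smul_apply, Pi.one_apply, smul_eq_mul] at e1 e2
    have b1 := abs_le.1 (hM s' hx t)
    have b2 := abs_le.1 (hM s hne (σ t))
    have hM0 : 0 ≤ M := (abs_nonneg _).trans (hM s hne t)
    have e3 : s' t - s (σ t) =
        n * ((2 * M + 1) * (((t : ℕ) : ℤ) - ((σ t : ℕ) : ℤ))) := by linarith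
    have hst : (t : ℕ) = (σ t : ℕ) := by
      by_contra hc
      have hc' : (((t : ℕ) : ℤ) - ((σ t : ℕ) : ℤ)) ≠ 0 := by
        intro hz; apply hc; omega
      have h3 : 2 * M + 1 ≤ |s' t - s (σ t)| := by
        rw [e3, abs_mul, abs_mul, abs_of_pos hn, abs_of_pos (by linarith : 0 < 2 * M + 1)]
        have h4 : 1 ≤ |((t : ℕ) : ℤ) - ((σ t : ℕ) : ℤ)| := Int.one_le_abs hc'
        nlinarith [mul_le_mul h4 (show (1 : ℤ) ≤ n from hn) (by norm_num) (abs_nonneg _)]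
      have h5 : |s' t - s (σ t)| ≤ 2 * M := abs_le.2 ⟨by linarith, by linarith⟩
      linarith
    rw [← hst, sub_self, mul_zero, mul_zero] at e3
    rw [← Fin.ext hst] at e3
    linarith

/-! ### Matrix coefficients of the elements `c_ε` -/

/-- The double cosets `Σ_ε \ Σ_r / Σ_i` parametrize without repetition the orbits of the pairs `(i,
i + nεσ)`, so each such orbit occurs exactly once in the sum. -/
theorem coeff_c [NeZero n] (ε : Fin r → ℤ) (p q : ZTuple r)
    [Decidable (∃ σ : Perm (Fin r), q = p + (n : ℤ) • (ε ∘ σ))] :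
    coeff (c K n ε) p q =
      if ∃ σ : Perm (Fin r), q = p + (n : ℤ) • (ε ∘ σ) then 1 else 0 := by
  classical
  have hn : (n : ℤ) ≠ 0 := by exact_mod_cast NeZero.ne n
  simp only [c, coeff_sum, coeff_xi]
  split_ifs with h
  · obtain ⟨σ, rfl⟩ := h
    obtain ⟨I, hI⟩ := exists_rep (n := n) p
    obtain ⟨τ, μ, h1, -⟩ := orb_eq_iff.1 hI
    have key : ∀ d : StabCosets ε I.rep,
        (orb n I.rep.toZ (fun t => I.rep.toZ t + (n : ℤ) * ε (Quotient.out d t)) =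
          orb n p (p + (n : ℤ) • (ε ∘ σ))) ↔
          d = DoubleCoset.mk (stab ε) (stab I.rep) (σ * τ⁻¹) := by
      intro d
      have hp : orb n p (p + (n : ℤ) • (ε ∘ σ)) =
          orb n I.rep.toZ (I.rep.toZ + (n : ℤ) • (ε ∘ (σ * τ⁻¹))) := by
        refine (orb_eq_iff.2 ⟨τ, μ, h1, ?_⟩).symm
        rw [← h1]; ext t; simp [act]; ring
      rw [hp]
      constructor
      · intro ho
        obtain ⟨ρ, ν, h2, h3⟩ := orb_eq_iff.1 ho
        have h4 : ∀ t, I.rep (ρ t) = I.rep t ∧ ν t = 0 := by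
          intro t
          have e := congrFun h2 t
          simp only [act, NTuple.toZ] at e
          have a1 := (I.rep (ρ t)).isLt
          have a2 := (I.rep t).isLt
          -- Entries of the representative lie in a window of length `n`, so two of them cannot
          -- differ by a nonzero multiple of `n`.
          have a3 : ν t = 0 := by
            by_contra hc
            have hb : (n : ℤ) ≤ |(n : ℤ) * ν t| := by
              rw [abs_mul, Nat.abs_cast]
              nlinarith [Int.one_le_abs hc]
            have : |(n : ℤ) * ν t| < n := abs_lt.2 ⟨by omega, by omega⟩
            linarith
          refine ⟨?_, a3⟩
          rw [a3] at e
          exact Fin.ext (by omega)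
        rw [← Quotient.out_eq d]
        -- The left factor is obtained by solving `σ τ⁻¹ = h d ρ` for `h`, where `d` is the chosen
        -- representative.
        refine (DoubleCoset.eq _ _ _ _).2
          ⟨σ * τ⁻¹ * ρ⁻¹ * (Quotient.out d)⁻¹, ?_, ρ, ?_, by group⟩
        · change ε ∘ _ = ε
          ext t
          have e := congrFun h3 (ρ⁻¹ ((Quotient.out d)⁻¹ t))
          have e' := congrFun h2 (ρ⁻¹ ((Quotient.out d)⁻¹ t))
          simp only [act, Pi.add_apply, Pi.smul_apply, smul_eq_mul, Function.comp_apply,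
            (h4 _).2] at e e'
          simp only [mul_zero, add_zero] at e e'
          rw [e'] at e
          have := mul_left_cancel₀ hn (add_left_cancel e)
          simpa using this.symm
        · change I.rep ∘ ρ = I.rep
          exact funext fun t => (h4 t).1
      · rintro rfl
        obtain ⟨a, b, ha, hb, hab⟩ :=
          DoubleCoset.mk_out_eq_mul (stab ε) (stab I.rep) (σ * τ⁻¹)
        have ha' : ε ∘ a = ε := ha
        have hb' : I.rep ∘ b = I.rep := hb
        rw [hab, ← orb_comp_perm b I.rep.toZ (I.rep.toZ + (n : ℤ) • (ε ∘ (σ * τ⁻¹)))]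
        have hb2 : I.rep.toZ ∘ b = I.rep.toZ := by
          ext t; simp only [NTuple.toZ, Function.comp_apply]
          rw [show I.rep (b t) = I.rep t from congrFun hb' t]
        rw [hb2]
        congr 1
        ext t
        simp only [Pi.add_apply, Pi.smul_apply, smul_eq_mul, Function.comp_apply, Perm.mul_apply]
        rw [show I.rep.toZ (b t) = I.rep.toZ t from congrFun hb2 t]
        rw [show ε (a (σ (τ⁻¹ (b t)))) = ε (σ (τ⁻¹ (b t))) from congrFun ha' _]
    rw [Finset.sum_eq_single I]
    · simp only [key, Finset.sum_ite_eq', Finset.mem_univ, if_true]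
    · intro J _ hJ
      refine Finset.sum_eq_zero fun d _ => if_neg fun ho => hJ ?_
      exact rep_unique ((orb_diag ho).1.trans hI.symm)
    · simp
  · refine Finset.sum_eq_zero fun I _ => Finset.sum_eq_zero fun d _ => if_neg fun ho => h ?_
    obtain ⟨τ, μ, h1, h2⟩ := orb_eq_iff.1 ho
    refine ⟨Quotient.out d * τ, ?_⟩
    rw [← h1, ← h2]; ext t; simp [act]; ring

theorem coeff_c_const [NeZero n] (k : ℤ) (p q : ZTuple r)
    [Decidable (q = p + (n : ℤ) • fun _ => k)] :
    coeff (c K n fun _ => k) p q = if q = p + (n : ℤ) • (fun _ => k) then 1 else 0 := by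
  classical
  rw [coeff_c]
  congr 1
  exact propext ⟨fun ⟨_, h⟩ => h, fun h => ⟨1, h⟩⟩

theorem coeff_mul_c_const [NeZero n] (f : Alg K n r) (k : ℤ) (p q : ZTuple r) :
    coeff (f * c K n fun _ => k) p q = coeff f p (q - (n : ℤ) • fun _ => k) := by
  classical
  rw [coeff_mul, finsum_eq_single _ (q - (n : ℤ) • fun _ => k) fun s hs => by
    rw [coeff_c_const, if_neg fun h => hs (by rw [h, add_sub_cancel_right]), mul_zero]]
  rw [coeff_c_const, if_pos (by simp), mul_one]

theorem coeff_mul_c_const_pow [NeZero n] (f : Alg K n r) (k : ℤ) (N : ℕ) (p q : ZTuple r) :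
    coeff (f * (c K n fun _ => k) ^ N) p q =
      coeff f p (q - (n : ℤ) • fun _ => (N : ℤ) * k) := by
  induction N generalizing q with
  | zero =>
    rw [pow_zero, mul_one]; congr 1; ext t; simp
  | succ N ih =>
    rw [pow_succ, ← mul_assoc, coeff_mul_c_const, ih]
    congr 1; ext t
    simp only [Pi.sub_apply, Pi.smul_apply, smul_eq_mul, Nat.cast_succ]; ring

/-- Constant exponents give translations, which compose additively; this makes `c_{ε^r}` invertible.
-/
theorem c_const_mul_c_const [NeZero n] (k l : ℤ) :
    (c K n fun _ : Fin r => k) * (c K n fun _ => l) = c K n fun _ => k + l := by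
  classical
  refine ext_coeff fun p q => ?_
  rw [coeff_mul_c_const, coeff_c_const, coeff_c_const]
  congr 1
  rw [sub_eq_iff_eq_add, add_assoc, ← smul_add]
  rfl

theorem c_zero [NeZero n] : (c K n fun _ : Fin r => 0) = 1 := by
  classical
  refine ext_coeff fun p q => ?_
  rw [coeff_c_const, coeff_one]
  congr 1
  refine propext ⟨fun h => ?_, fun h => ?_⟩
  · rw [h]; ext t; simp
  · rw [h]; ext t; simp

theorem eps_self : eps r r = fun _ => 1 := by
  ext t; simp [eps]

/-! ### Symmetric polynomials as central elements -/

/-- The shift by `n m`, as a tuple, attached to an exponent `m`. -/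
def natShift (n : ℕ) {r : ℕ} (m : Fin r →₀ ℕ) : ZTuple r := fun t => (n : ℤ) * (m t : ℤ)

theorem natShift_add (m m' : Fin r →₀ ℕ) :
    natShift n (m + m') = natShift n m + natShift n m' := by
  ext t; simp [natShift, mul_add]

theorem natShift_zero : natShift n (0 : Fin r →₀ ℕ) = 0 := by
  ext t; simp [natShift]

theorem natShift_injective [NeZero n] :
    Function.Injective (natShift n : (Fin r →₀ ℕ) → ZTuple r) := by
  intro m m' h
  ext t
  have hn : (n : ℤ) ≠ 0 := by exact_mod_cast NeZero.ne n
  exact_mod_cast mul_left_cancel₀ hn (congrFun h t)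

open Classical in
/-- The matrix coefficient at `(a, b)` of a polynomial acting on tuples by shifts by `n m`. -/
noncomputable def shiftCoeff (n : ℕ) (p : MvPolynomial (Fin r) K) (a b : ZTuple r) : K :=
  if h : ∃ m : Fin r →₀ ℕ, b = a + natShift n m then p.coeff h.choose else 0

theorem shiftCoeff_add_natShift [NeZero n] (p : MvPolynomial (Fin r) K) (a : ZTuple r)
    (m : Fin r →₀ ℕ) : shiftCoeff n p a (a + natShift n m) = p.coeff m := by
  have h : ∃ m' : Fin r →₀ ℕ, a + natShift n m = a + natShift n m' := ⟨m, rfl⟩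
  rw [shiftCoeff, dif_pos h, natShift_injective (add_left_cancel h.choose_spec).symm]

theorem shiftCoeff_eq_zero (p : MvPolynomial (Fin r) K) {a b : ZTuple r}
    (h : ∀ m : Fin r →₀ ℕ, b ≠ a + natShift n m) : shiftCoeff n p a b = 0 :=
  dif_neg fun ⟨m, hm⟩ => h m hm

theorem shiftCoeff_ne_zero [NeZero n] {p : MvPolynomial (Fin r) K} {a b : ZTuple r}
    (h : shiftCoeff n p a b ≠ 0) : ∃ m ∈ p.support, b = a + natShift n m := by
  by_cases hm : ∃ m : Fin r →₀ ℕ, b = a + natShift n m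
  · obtain ⟨m, rfl⟩ := hm
    rw [shiftCoeff_add_natShift] at h
    exact ⟨m, mem_support_iff.2 h, rfl⟩
  · exact absurd (shiftCoeff_eq_zero p fun m h' => hm ⟨m, h'⟩) h

theorem _root_.MvPolynomial.IsSymmetric.coeff_mapDomain {σ R : Type*} [CommSemiring R]
    {p : MvPolynomial σ R} (hp : p.IsSymmetric) (e : Perm σ) (m : σ →₀ ℕ) :
    p.coeff (m.mapDomain e) = p.coeff m := by
  conv_lhs => rw [← hp e]
  exact coeff_rename_mapDomain e e.injective p m

/-- The translation cancels in `b - a`, and the permutation only rearranges the exponent, which a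
symmetric polynomial does not detect. -/
theorem shiftCoeff_act [NeZero n] {p : MvPolynomial (Fin r) K} (hp : p.IsSymmetric)
    (σ : Perm (Fin r)) (μ : Fin r → ℤ) (a b : ZTuple r) :
    shiftCoeff n p (act n σ μ a) (act n σ μ b) = shiftCoeff n p a b := by
  have key : ∀ m : Fin r →₀ ℕ,
      act n σ μ (a + natShift n m) = act n σ μ a + natShift n (m.mapDomain σ.symm) := by
    intro m
    ext t
    have : m.mapDomain σ.symm t = m (σ t) := by
      rw [Finsupp.mapDomain_equiv_apply, symm_symm]
    simp only [act, natShift, Pi.add_apply, this]; ring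
  by_cases hm : ∃ m : Fin r →₀ ℕ, b = a + natShift n m
  · obtain ⟨m, rfl⟩ := hm
    rw [key, shiftCoeff_add_natShift, shiftCoeff_add_natShift, hp.coeff_mapDomain]
  · rw [shiftCoeff_eq_zero p fun m h => hm ⟨m, h⟩, shiftCoeff_eq_zero]
    intro m h
    refine hm ⟨m.mapDomain σ, (actEquiv n σ μ).injective ?_⟩
    change act n σ μ b = act n σ μ _
    rw [h, key, ← Finsupp.mapDomain_comp]
    simp

theorem shiftCoeff_add_left [NeZero n] (p : MvPolynomial (Fin r) K) (a b d : ZTuple r) :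
    shiftCoeff n p (a + d) (b + d) = shiftCoeff n p a b := by
  have : ∀ m : Fin r →₀ ℕ, b + d = a + d + natShift n m ↔ b = a + natShift n m := fun m => by
    rw [add_right_comm, add_left_inj]
  by_cases hm : ∃ m : Fin r →₀ ℕ, b = a + natShift n m
  · obtain ⟨m, rfl⟩ := hm
    rw [shiftCoeff_add_natShift, add_right_comm, shiftCoeff_add_natShift]
  · rw [shiftCoeff_eq_zero p fun m h => hm ⟨m, h⟩,
      shiftCoeff_eq_zero p fun m h => hm ⟨m, (this m).1 h⟩]

/-- The element of the affine Schur algebra attached to a symmetric polynomial. -/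
noncomputable def ofSymm (n : ℕ) [NeZero n] (p : symmetricSubalgebra (Fin r) K) : Alg K n r :=
  (Finsupp.ofSupportFinite
    (Quotient.lift (fun x : ZTuple r × ZTuple r => shiftCoeff n p.1 x.1 x.2) (by
      rintro x y ⟨σ, μ, h1, h2⟩
      rw [← h1, ← h2, shiftCoeff_act p.2]))
    (by
      -- The first tuple can be moved to one of finitely many representatives, and then the second
      -- is determined by an exponent in the support.
      refine ((Set.finite_univ (α := TupleClass n r)).image2
        (fun (I : TupleClass n r) m => orb n I.rep.toZ (I.rep.toZ + natShift n m))
        p.1.support.finite_toSet).subset ?_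
      intro C hC
      obtain ⟨a, b, rfl⟩ := exists_orb C
      have hC' : shiftCoeff n p.1 a b ≠ 0 := hC
      obtain ⟨I, hI⟩ := exists_rep (n := n) a
      obtain ⟨σ, μ, h1, -⟩ := orb_eq_iff.1 hI.symm
      rw [← shiftCoeff_act p.2 σ μ, h1] at hC'
      obtain ⟨m, hm, h2⟩ := shiftCoeff_ne_zero hC'
      exact ⟨I, Set.mem_univ _, m, hm, by
        change orb n _ _ = _
        rw [← h2, ← orb_act σ μ a b, h1]⟩) : PairOrbit n r →₀ K)

theorem coeff_ofSymm [NeZero n] (p : symmetricSubalgebra (Fin r) K) (a b : ZTuple r) :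
    coeff (ofSymm n p) a b = shiftCoeff n p.1 a b := rfl

/-- A path from `a` to `a + n m` passes through some `a + n m₁` with `m₁ + m₂ = m`, so convolution
is the product formula for polynomial coefficients. -/
theorem ofSymm_mul [NeZero n] (p q : symmetricSubalgebra (Fin r) K) :
    ofSymm n (p * q) = ofSymm n p * ofSymm n q := by
  classical
  refine ext_coeff fun a b => ?_
  rw [coeff_mul]
  simp only [coeff_ofSymm]
  by_cases hb : ∃ m : Fin r →₀ ℕ, b = a + natShift n m
  · obtain ⟨m, rfl⟩ := hb
    rw [shiftCoeff_add_natShift, finsum_eq_sum_of_support_subset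
      (s := (Finset.HasAntidiagonal.antidiagonal m).image fun x => a + natShift n x.1)]
    · rw [Finset.sum_image]
      · change MvPolynomial.coeff m (p.1 * q.1) = _
        rw [MvPolynomial.coeff_mul]
        refine Finset.sum_congr rfl fun x hx => ?_
        rw [shiftCoeff_add_natShift, ← Finset.HasAntidiagonal.mem_antidiagonal.1 hx, natShift_add, ← add_assoc,
          shiftCoeff_add_natShift]
      · intro x hx y hy h
        have h1 := natShift_injective (add_left_cancel h)
        have h2 := (Finset.HasAntidiagonal.mem_antidiagonal.1 hx).trans
          (Finset.HasAntidiagonal.mem_antidiagonal.1 hy).symm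
        rw [h1] at h2
        exact Prod.ext h1 (add_left_cancel h2)
    · intro s hs
      obtain ⟨m₁, -, rfl⟩ := shiftCoeff_ne_zero (left_ne_zero_of_mul hs)
      obtain ⟨m₂, -, h₂⟩ := shiftCoeff_ne_zero (right_ne_zero_of_mul hs)
      rw [add_assoc, ← natShift_add] at h₂
      refine Finset.mem_coe.2 (Finset.mem_image.2 ⟨(m₁, m₂), ?_, rfl⟩)
      exact Finset.HasAntidiagonal.mem_antidiagonal.2 (natShift_injective (add_left_cancel h₂)).symm
  · rw [shiftCoeff_eq_zero _ fun m h => hb ⟨m, h⟩]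
    refine (finsum_eq_zero_of_forall_eq_zero fun s => ?_).symm
    by_contra hs
    obtain ⟨m₁, -, rfl⟩ := shiftCoeff_ne_zero (left_ne_zero_of_mul hs)
    obtain ⟨m₂, -, h₂⟩ := shiftCoeff_ne_zero (right_ne_zero_of_mul hs)
    exact hb ⟨m₁ + m₂, by rw [h₂, natShift_add, add_assoc]⟩

theorem coeff_algebraMap [NeZero n] (x : K) (a b : ZTuple r) [Decidable (a = b)] :
    coeff (algebraMap K (Alg K n r) x) a b = if a = b then x else 0 := by
  classical
  rw [Algebra.algebraMap_eq_smul_one, coeff_smul, coeff_one]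
  split_ifs <;> simp

theorem ofSymm_algebraMap [NeZero n] (x : K) :
    ofSymm n (algebraMap K (symmetricSubalgebra (Fin r) K) x) =
      algebraMap K (Alg K n r) x := by
  classical
  refine ext_coeff fun a b => ?_
  rw [coeff_algebraMap, coeff_ofSymm]
  by_cases hb : ∃ m : Fin r →₀ ℕ, b = a + natShift n m
  · obtain ⟨m, rfl⟩ := hb
    rw [shiftCoeff_add_natShift]
    change MvPolynomial.coeff m (MvPolynomial.C x) = _
    rw [MvPolynomial.coeff_C]
    refine if_congr ⟨?_, fun h => ?_⟩ rfl rfl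
    · rintro rfl; rw [natShift_zero, add_zero]
    · refine natShift_injective (n := n) (add_left_cancel (a := a) ?_)
      rw [natShift_zero, add_zero, ← h]
  · rw [shiftCoeff_eq_zero _ fun m h => hb ⟨m, h⟩, if_neg]
    rintro rfl
    exact hb ⟨0, by rw [natShift_zero, add_zero]⟩

/-- `ofSymm` as a homomorphism of algebras. -/
noncomputable def ofSymmHom (n : ℕ) [NeZero n] :
    symmetricSubalgebra (Fin r) K →ₐ[K] Alg K n r where
  toFun := ofSymm n
  map_one' := by
    have := ofSymm_algebraMap (n := n) (r := r) (1 : K)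
    rwa [map_one, map_one] at this
  map_mul' := ofSymm_mul
  map_zero' := by
    have := ofSymm_algebraMap (n := n) (r := r) (0 : K)
    rwa [map_zero, map_zero] at this
  map_add' p q := by
    refine ext_coeff fun a b => ?_
    rw [coeff_add]
    simp only [coeff_ofSymm]
    by_cases hb : ∃ m : Fin r →₀ ℕ, b = a + natShift n m
    · obtain ⟨m, rfl⟩ := hb
      simp only [shiftCoeff_add_natShift]
      exact MvPolynomial.coeff_add m p.1 q.1
    · simp only [shiftCoeff_eq_zero _ fun m h => hb ⟨m, h⟩, add_zero]
  commutes' := ofSymm_algebraMap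

theorem ofSymm_injective [NeZero n] :
    Function.Injective (ofSymm n : symmetricSubalgebra (Fin r) K → Alg K n r) := by
  intro p q h
  refine Subtype.ext (MvPolynomial.ext _ _ fun m => ?_)
  have := congrArg (fun f => coeff f 0 (0 + natShift n m)) h
  simpa only [coeff_ofSymm, shiftCoeff_add_natShift] using this

/-- The reflection `s ↦ a + b - s` matches the two convolution sums term by term: the polynomial
factor depends only on a difference, and `f` is invariant under simultaneous translation of both
arguments by `n m`. -/
theorem ofSymm_mem_center [NeZero n] (p : symmetricSubalgebra (Fin r) K) :
    ofSymm n p ∈ Subalgebra.center K (Alg K n r) := by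
  refine Subalgebra.mem_center_iff.2 fun f => ext_coeff fun a b => ?_
  rw [coeff_mul, coeff_mul, ← finsum_comp_equiv (Equiv.subLeft (a + b))]
  refine finsum_congr fun s => ?_
  rw [coeff_ofSymm, coeff_ofSymm, mul_comm, Equiv.subLeft_apply]
  have h1 : shiftCoeff n p.1 (a + b - s) b = shiftCoeff n p.1 a s := by
    rw [← shiftCoeff_add_left p.1 a s (b - s)]
    congr 1 <;> abel
  rw [h1]
  by_cases hs : ∃ m : Fin r →₀ ℕ, s = a + natShift n m
  · obtain ⟨m, rfl⟩ := hs
    congr 1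
    refine coeff_congr f ?_
    rw [← orb_translate (fun t => (m t : ℤ)) a]
    congr 1
    ext t
    simp only [natShift, Pi.add_apply, Pi.sub_apply, Pi.smul_apply, smul_eq_mul]; ring
  · rw [shiftCoeff_eq_zero _ fun m h => hs ⟨m, h⟩, zero_mul, zero_mul]

/-! ### Elementary symmetric polynomials -/

theorem exists_perm_image_eq {α : Type*} [Fintype α] [DecidableEq α] {s t : Finset α}
    (h : s.card = t.card) : ∃ σ : Perm α, ∀ x, σ x ∈ s ↔ x ∈ t := by
  let e : {x // x ∈ t} ≃ {x // x ∈ s} := Finset.equivOfCardEq h.symm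
  refine ⟨e.extendSubtype, fun x => ⟨fun hx => ?_, fun hx => e.extendSubtype_mem x hx⟩⟩
  by_contra hc
  exact e.extendSubtype_not_mem x hc hx

/-- The exponents occurring are the indicators of `k`-element subsets, each with coefficient one;
these are precisely the rearrangements of `ε^k`. -/
theorem ofSymm_esymm [NeZero n] (k : ℕ) (hk : k ≤ r)
    (p : symmetricSubalgebra (Fin r) K) (hp : p.1 = esymm (Fin r) K k) :
    ofSymm n p = c K n (eps r k) := by
  classical
  refine ext_coeff fun a b => ?_
  let T : Finset (Fin r) := Finset.univ.filter fun t => (t : ℕ) < k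
  have hT : T.card = k := by
    simp only [T]
    rw [Fin.card_filter_val_lt]; exact min_eq_right hk
  have hind : ∀ (s : Finset (Fin r)) (t : Fin r),
      (∑ i ∈ s, Finsupp.single i 1 : Fin r →₀ ℕ) t = if t ∈ s then 1 else 0 := by
    intro s t
    simp [Finsupp.finsetSum_apply, Finsupp.single_apply]
  have heps : ∀ σ : Perm (Fin r), ∃ s : Finset (Fin r), s.card = k ∧
      (n : ℤ) • (eps r k ∘ σ) = natShift n (∑ i ∈ s, Finsupp.single i 1 : Fin r →₀ ℕ) := by
    intro σ
    -- `ε^k ∘ σ` is the indicator of the preimage of `T` under `σ`.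
    refine ⟨T.map σ⁻¹.toEmbedding, by rw [Finset.card_map, hT], ?_⟩
    ext t
    simp only [natShift, hind, Pi.smul_apply, smul_eq_mul, Function.comp_apply, eps,
      Finset.mem_map_equiv, T, Finset.mem_filter, Finset.mem_univ, true_and]
    simp
    rfl
  rw [coeff_c, coeff_ofSymm, hp]
  split_ifs with h
  · obtain ⟨σ, rfl⟩ := h
    obtain ⟨s, hs, h⟩ := heps σ
    rw [h, shiftCoeff_add_natShift, esymm_eq_sum_monomial, MvPolynomial.coeff_sum,
      Finset.sum_eq_single s]
    · rw [coeff_monomial, if_pos rfl]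
    · intro s' _ hne
      rw [coeff_monomial, if_neg]
      intro hc
      refine hne (Finset.ext fun t => ?_)
      have := DFunLike.congr_fun hc t
      rw [hind, hind] at this
      by_cases h1 : t ∈ s' <;> by_cases h2 : t ∈ s <;> simp_all
    · intro hc
      exact absurd (Finset.mem_powersetCard.2 ⟨Finset.subset_univ _, hs⟩) hc
  · by_contra hne
    obtain ⟨m, hm, rfl⟩ := shiftCoeff_ne_zero hne
    rw [mem_support_iff, esymm_eq_sum_monomial, MvPolynomial.coeff_sum] at hm
    obtain ⟨s, hs, hsm⟩ := Finset.exists_ne_zero_of_sum_ne_zero hm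
    rw [coeff_monomial] at hsm
    have hms : ∑ i ∈ s, Finsupp.single i 1 = m := by
      by_contra hc; exact hsm (if_neg hc)
    obtain ⟨σ, hσ⟩ := exists_perm_image_eq (hT.trans (Finset.mem_powersetCard.1 hs).2.symm)
    refine h ⟨σ, ?_⟩
    congr 1
    ext t
    rw [← hms]
    simp only [natShift, hind, Pi.smul_apply, smul_eq_mul, Function.comp_apply, eps, ← hσ t, T,
      Finset.mem_filter, Finset.mem_univ, true_and]
    split_ifs <;> simp

/-! ### The corner as symmetric Laurent polynomials -/

/-- Up to a power of `c_{ε^r}`, elements of the corner `ξ_{1⋯1, 1⋯1} S̃(n, r) ξ_{1⋯1, 1⋯1}` come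
from symmetric polynomials. -/
theorem exists_mul_pow_eq_ofSymm_mul [NeZero n] (x : Alg K n r)
    (hl : xi K n (1 : ZTuple r) 1 * x = x) (hr : x * xi K n (1 : ZTuple r) 1 = x) :
    ∃ (p : symmetricSubalgebra (Fin r) K) (N : ℕ),
      x * (c K n fun _ => 1) ^ N = ofSymm n p * xi K n (1 : ZTuple r) 1 := by
  classical
  have hn : (n : ℤ) ≠ 0 := by exact_mod_cast NeZero.ne n
  have hfin := coeff_finite_right x 1
  obtain ⟨N, hN⟩ : ∃ N : ℕ, ∀ μ : Fin r → ℤ, coeff x 1 (1 + (n : ℤ) • μ) ≠ 0 →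
      ∀ t, 0 ≤ μ t + N := by
    -- Dividing by `n` recovers `μ` from `s = 1 + nμ`; the total over the finite support bounds
    -- every negative exponent.
    refine ⟨∑ s ∈ hfin.toFinset, ∑ t, ((s t - 1) / n).natAbs, fun μ hμ t => ?_⟩
    have h1 : (μ t).natAbs ≤ ∑ t, (((1 + (n : ℤ) • μ) t - 1) / n).natAbs := by
      refine le_trans (le_of_eq ?_) (Finset.single_le_sum
        (f := fun t => (((1 + (n : ℤ) • μ) t - 1) / (n : ℤ)).natAbs)
        (fun _ _ => Nat.zero_le _) (Finset.mem_univ t))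
      simp only [Pi.add_apply, Pi.one_apply, Pi.smul_apply, smul_eq_mul, add_sub_cancel_left,
        Int.mul_ediv_cancel_left _ hn]
    have h2 : _ ≤ ∑ s ∈ hfin.toFinset, ∑ t, ((s t - 1) / (n : ℤ)).natAbs := h1.trans (Finset.single_le_sum
      (f := fun s : ZTuple r => ∑ t, ((s t - 1) / (n : ℤ)).natAbs)
      (fun _ _ => Nat.zero_le _) (hfin.mem_toFinset.2 hμ))
    omega
  -- Multiplication by the `N`-th power of `c_{ε^r}` raises all exponents by `N`, so the coefficient
  -- of `m` in the product is that of `m - (N, …, N)` in `x`.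
  let g : (Fin r →₀ ℕ) → ZTuple r := fun m => 1 + natShift n m - (n : ℤ) • fun _ => (N : ℤ)
  have hg : Function.Injective g := fun m m' h =>
    natShift_injective (add_left_cancel (sub_left_injective h))
  let p : MvPolynomial (Fin r) K :=
    ∑ m ∈ (hfin.preimage hg.injOn).toFinset, monomial m (coeff x 1 (g m))
  have hp : ∀ m, p.coeff m = coeff x 1 (g m) := by
    intro m
    simp only [p, MvPolynomial.coeff_sum, coeff_monomial, Finset.sum_ite_eq']
    split_ifs with h
    · rfl
    · by_contra hc
      exact h ((Set.Finite.mem_toFinset _).2 (Ne.symm hc))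
  -- Permutations fix the first tuple `1` and the constant shift, so invariance of `x` becomes
  -- symmetry in the exponent.
  have hsymm : p.IsSymmetric := by
    intro e
    refine MvPolynomial.ext _ _ fun m => ?_
    have hm : m = (m.mapDomain e.symm).mapDomain e := by
      rw [← Finsupp.mapDomain_comp]; simp
    rw [hm, coeff_rename_mapDomain e e.injective, ← hm, hp, hp]
    refine coeff_congr x ?_
    rw [← orb_comp_perm e 1 (g m)]
    congr 1
    ext t
    simp [g, natShift, Finsupp.mapDomain_equiv_apply]
  refine ⟨⟨p, (mem_symmetricSubalgebra p).2 hsymm⟩, N, ext_coeff fun a b => ?_⟩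
  rw [coeff_mul_c_const_pow, coeff_mul_xi_self, coeff_ofSymm]
  simp only [mul_one]
  have hshift : ∀ d : ZTuple r, orb n (1 : ZTuple r) 1 =
      orb n (d - (n : ℤ) • fun _ => (N : ℤ)) (d - (n : ℤ) • fun _ => (N : ℤ)) ↔
      orb n (1 : ZTuple r) 1 = orb n d d := by
    intro d
    rw [← orb_translate (fun _ => (N : ℤ)) (d - _), sub_add_cancel]
  -- Both sides vanish unless `a` and `b` lie in the orbit of `1`; there, translating `a` to `1`
  -- reduces to the coefficients of `p`.
  by_cases hb : orb n (1 : ZTuple r) 1 = orb n b b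
  · rw [if_pos hb]
    by_cases ha : orb n (1 : ZTuple r) 1 = orb n a a
    · obtain ⟨α, rfl⟩ := orb_one_eq_iff.1 ha
      obtain ⟨β, rfl⟩ := orb_one_eq_iff.1 hb
      have e1 : coeff x (1 + (n : ℤ) • α) (1 + (n : ℤ) • β - (n : ℤ) • fun _ => (N : ℤ)) =
          coeff x 1 (1 + (n : ℤ) • (β - α - fun _ => (N : ℤ))) := by
        refine coeff_congr x ?_
        rw [← orb_translate α 1]
        congr 1
        ext t; simp; ring
      rw [e1]
      by_cases hm : ∃ m : Fin r →₀ ℕ,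
          1 + (n : ℤ) • β = 1 + (n : ℤ) • α + natShift n m
      · obtain ⟨m, hm⟩ := hm
        rw [hm, shiftCoeff_add_natShift, hp]
        congr 1
        ext t
        have := congrFun hm t
        simp only [Pi.add_apply, Pi.smul_apply, Pi.sub_apply, smul_eq_mul, g] at this ⊢
        linear_combination this
      · rw [shiftCoeff_eq_zero _ fun m h => hm ⟨m, h⟩]
        -- If the entry of `x` were nonzero, the choice of `N` would make `β - α` nonnegative, hence
        -- an exponent.
        by_contra hc
        have h0 := hN _ hc
        simp only [Pi.sub_apply, sub_add_cancel] at h0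
        refine hm ⟨Finsupp.equivFunOnFinite.symm fun t => (β t - α t).toNat, ?_⟩
        ext t
        simp only [natShift, Finsupp.equivFunOnFinite_symm_apply_apply, Int.toNat_of_nonneg (h0 t),
          Pi.add_apply, Pi.smul_apply, smul_eq_mul]
        ring
    · rw [← hl, coeff_xi_self_mul, if_neg ha, shiftCoeff_eq_zero]
      rintro m rfl
      refine ha (hb.trans ?_)
      exact orb_translate (fun t => (m t : ℤ)) a a
  · rw [if_neg hb, ← hr, coeff_mul_xi_self, if_neg]
    exact fun h => hb ((hshift b).1 h)

/-! ### Structure of the center -/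

theorem center_mul_comm [NeZero n] {z : Alg K n r} (hz : z ∈ Subalgebra.center K (Alg K n r))
    (f : Alg K n r) : z * f = f * z :=
  (Subalgebra.mem_center_iff.1 hz f).symm

/-- Centrality gives `z y ξ = y z ξ = 0` for every `y`, so faithfulness applies. -/
theorem eq_zero_of_mem_center_of_mul_xi_one [NeZero n] {z : Alg K n r}
    (hz : z ∈ Subalgebra.center K (Alg K n r))
    (h : z * xi K n (1 : ZTuple r) 1 = 0) : z = 0 :=
  eq_zero_of_forall_mul_xi_one z fun y => by
    rw [center_mul_comm hz, mul_assoc, h, mul_zero]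

variable (K n r) in
/-- The homomorphism `K[t_1, …, t_r] → Z` sending `t_k` to `c_{ε^k}`. -/
noncomputable def polyToCenter [NeZero n] :
    MvPolynomial (Fin r) K →ₐ[K] Subalgebra.center K (Alg K n r) :=
  ((ofSymmHom n).codRestrict _ ofSymm_mem_center).comp (esymmAlgHom (Fin r) K r)

theorem coe_polyToCenter [NeZero n] (p : MvPolynomial (Fin r) K) :
    (polyToCenter K n r p : Alg K n r) = ofSymm n (esymmAlgHom (Fin r) K r p) := rfl

theorem coe_polyToCenter_X [NeZero n] (k : Fin r) :
    (polyToCenter K n r (X k) : Alg K n r) = c K n (eps r (k + 1)) := by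
  rw [coe_polyToCenter]
  refine ofSymm_esymm _ k.isLt _ ?_
  simp [esymmAlgHom]

/-- This rests on the algebraic independence of the elementary symmetric polynomials. -/
theorem polyToCenter_injective [NeZero n] : Function.Injective (polyToCenter K n r) := by
  intro p q h
  exact (esymmAlgHom_fin_bijective K r).1 (ofSymm_injective (congrArg Subtype.val h))

/-- `Fin.rev 0` has value `r - 1`, so with variables numbered from zero it stands for `t_r`. -/
theorem coe_polyToCenter_X_last [NeZero n] [NeZero r] :
    (polyToCenter K n r (X (Fin.rev 0)) : Alg K n r) = c K n (fun _ => 1) := by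
  rw [coe_polyToCenter_X, ← eps_self]
  congr 2
  have := Nat.pos_of_ne_zero (NeZero.ne r)
  simp only [Fin.val_rev, Fin.val_zero]
  omega

theorem c_neg_eps_self : c K n (-eps r r) = c K n (fun _ => -1) := by
  rw [eps_self]; rfl

theorem c_one_mul_c_neg_one [NeZero n] :
    (c K n fun _ : Fin r => 1) * (c K n fun _ => -1) = 1 := by
  rw [c_const_mul_c_const]; exact c_zero

theorem c_neg_one_mul_c_one [NeZero n] :
    (c K n fun _ : Fin r => -1) * (c K n fun _ => 1) = 1 := by
  rw [c_const_mul_c_const]; exact c_zero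

theorem c_neg_one_mem_center [NeZero n] [NeZero r] :
    (c K n fun _ : Fin r => -1) ∈ Subalgebra.center K (Alg K n r) := by
  refine Subalgebra.mem_center_iff.2 fun f => ?_
  have h1 : (c K n fun _ : Fin r => 1) ∈ Subalgebra.center K (Alg K n r) := by
    rw [← coe_polyToCenter_X_last]; exact Subtype.property _
  calc f * c K n (fun _ => -1)
      = c K n (fun _ => -1) * (c K n (fun _ => 1) * f) * c K n (fun _ => -1) := by
        rw [← mul_assoc (c K n _), c_neg_one_mul_c_one, one_mul]
    _ = c K n (fun _ => -1) * f := by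
        rw [center_mul_comm h1, mul_assoc, mul_assoc, c_one_mul_c_neg_one, mul_one]

/-- Elements of the corner are central elements times `ξ_{1⋯1, 1⋯1}`, in a controlled form. -/
theorem exists_eq_polyToCenter_mul_pow [NeZero n] [NeZero r] (x : Alg K n r)
    (hl : xi K n (1 : ZTuple r) 1 * x = x) (hr : x * xi K n (1 : ZTuple r) 1 = x) :
    ∃ (p : MvPolynomial (Fin r) K) (N : ℕ),
      x = (polyToCenter K n r p * ⟨_, c_neg_one_mem_center⟩ ^ N :
        Subalgebra.center K (Alg K n r)).1 * xi K n (1 : ZTuple r) 1 := by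
  obtain ⟨q, N, h⟩ := exists_mul_pow_eq_ofSymm_mul x hl hr
  obtain ⟨p, rfl⟩ := (esymmAlgHom_fin_bijective K r).2 q
  refine ⟨p, N, ?_⟩
  have hc : Commute (c K n fun _ : Fin r => 1) (c K n fun _ => -1) :=
    c_one_mul_c_neg_one.trans c_neg_one_mul_c_one.symm
  have hcen := Subalgebra.pow_mem _ (c_neg_one_mem_center (K := K) (n := n) (r := r)) N
  calc x = x * (c K n fun _ => 1) ^ N * (c K n fun _ => -1) ^ N := by
        rw [mul_assoc, ← hc.mul_pow, c_one_mul_c_neg_one, one_pow, mul_one]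
    _ = _ := by
        rw [h, mul_assoc, ← center_mul_comm hcen, ← mul_assoc]; rfl

/-- `z ξ` lies in the corner, hence equals `w ξ` for a central `w` of the required form; then `(z -
w) ξ = 0` gives `z = w`. -/
theorem exists_center_eq [NeZero n] [NeZero r] (z : Subalgebra.center K (Alg K n r)) :
    ∃ (p : MvPolynomial (Fin r) K) (N : ℕ),
      z = polyToCenter K n r p * ⟨_, c_neg_one_mem_center⟩ ^ N := by
  have hi : xi K n (1 : ZTuple r) 1 * xi K n 1 1 = xi K n 1 1 := xi_self_idem 1
  obtain ⟨p, N, h⟩ := exists_eq_polyToCenter_mul_pow (z.1 * xi K n (1 : ZTuple r) 1)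
    (by rw [← mul_assoc, ← center_mul_comm z.2, mul_assoc, hi]) (by rw [mul_assoc, hi])
  refine ⟨p, N, sub_eq_zero.1 (Subtype.ext ?_)⟩
  exact eq_zero_of_mem_center_of_mul_xi_one (Subtype.property _) ((sub_mul _ _ _).trans
    (sub_eq_zero.2 h))

theorem exists_polyLaurent_equiv_center (K : Type u) [Field K] (n r : ℕ) [NeZero n] [NeZero r] :
    ∃ φ : PolyLaurent K r ≃ₐ[K] Subalgebra.center K (Alg K n r),
      (∀ p, φ (algebraMap (MvPolynomial (Fin r) K) (PolyLaurent K r) p) =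
        polyToCenter K n r p) ∧
      φ (IsLocalization.Away.invSelf (X (Fin.rev 0) : MvPolynomial (Fin r) K)) =
        ⟨_, c_neg_one_mem_center⟩ := by
  have hunit : polyToCenter K n r (X (Fin.rev 0)) * ⟨_, c_neg_one_mem_center⟩ = 1 :=
    Subtype.ext (by
      rw [Subalgebra.coe_mul, coe_polyToCenter_X_last]; exact c_one_mul_c_neg_one)
  have hu : ∀ y : Submonoid.powers (X (Fin.rev 0) : MvPolynomial (Fin r) K),
      IsUnit (polyToCenter K n r y) := by
    rintro ⟨_, N, rfl⟩
    simp only [map_pow]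
    exact (IsUnit.of_mul_eq_one _ hunit).pow N
  let F : PolyLaurent K r →ₐ[K] Subalgebra.center K (Alg K n r) := IsLocalization.liftAlgHom hu
  have hF : ∀ p, F (algebraMap (MvPolynomial (Fin r) K) (PolyLaurent K r) p) =
      polyToCenter K n r p := fun p => IsLocalization.lift_eq hu p
  have hinv : F (IsLocalization.Away.invSelf (X (Fin.rev 0) : MvPolynomial (Fin r) K)) =
      ⟨_, c_neg_one_mem_center⟩ := by
    have h := congrArg F (IsLocalization.Away.mul_invSelf (S := PolyLaurent K r)
      (X (Fin.rev 0) : MvPolynomial (Fin r) K))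
    rw [map_mul, map_one, hF] at h
    exact (left_inv_eq_right_inv ((mul_comm _ _).trans hunit) h).symm
  refine ⟨AlgEquiv.ofBijective F ⟨?_, fun z => ?_⟩, hF, hinv⟩
  · refine (injective_iff_map_eq_zero F).2 fun x hx => ?_
    obtain ⟨⟨p, s⟩, hs⟩ := IsLocalization.surj
      (Submonoid.powers (X (Fin.rev 0) : MvPolynomial (Fin r) K)) x
    have h := congrArg F hs
    rw [map_mul, hx, zero_mul, hF, ← map_zero (polyToCenter K n r)] at h
    have h0 : (0 : MvPolynomial (Fin r) K) = p := polyToCenter_injective h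
    rw [← h0, map_zero] at hs
    exact (IsLocalization.map_units (PolyLaurent K r) s).mul_left_eq_zero.1 hs
  · obtain ⟨p, N, rfl⟩ := exists_center_eq z
    exact ⟨_, by rw [← hF, ← hinv, ← map_pow, ← map_mul]⟩

theorem center_eq_adjoin (K : Type u) [Field K] (n r : ℕ) [NeZero n] [NeZero r] :
    Subalgebra.center K (Alg K n r) =
      Algebra.adjoin K (Set.range (fun k : Fin r => c K n (eps r (k + 1))) ∪
        {c K n (-eps r r)}) := by
  refine le_antisymm (fun z hz => ?_) (Algebra.adjoin_le ?_)
  · obtain ⟨p, N, h⟩ := exists_center_eq ⟨z, hz⟩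
    have h' : z = (polyToCenter K n r p : Alg K n r) * (c K n fun _ => -1) ^ N := congrArg Subtype.val h
    rw [h']
    clear h h' hz z
    refine Subalgebra.mul_mem _ ?_ (Subalgebra.pow_mem _ (Algebra.subset_adjoin
      (Set.mem_union_right _ (Set.mem_singleton_iff.2 c_neg_eps_self.symm))) N)
    induction p using MvPolynomial.induction_on with
    | C a =>
      rw [← MvPolynomial.algebraMap_eq, AlgHom.commutes]
      exact Subalgebra.algebraMap_mem _ a
    | add p q hp hq =>
      rw [map_add]
      exact Subalgebra.add_mem _ hp hq
    | mul_X p k hp =>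
      rw [map_mul, Subalgebra.coe_mul, coe_polyToCenter_X]
      exact Subalgebra.mul_mem _ hp (Algebra.subset_adjoin (Or.inl ⟨k, rfl⟩))
  · rintro _ (⟨k, rfl⟩ | rfl)
    · change c K n (eps r (k + 1)) ∈ _
      rw [← coe_polyToCenter_X]; exact Subtype.property _
    · rw [c_neg_eps_self]; exact c_neg_one_mem_center

/-! ### Comparison of the center with the corner -/

variable (K n r) in
/-- Multiplication by `ξ_{1⋯1, 1⋯1}`, from the center to the corner. -/
noncomputable def centerToCorner [NeZero n] :
    Subalgebra.center K (Alg K n r) →ₐ[K] CentralizerAlg K n (fun _ : Fin r => (1 : ℤ)) where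
  toFun z := ⟨z.1 * xi K n (fun _ => 1) fun _ => 1, z.1, by
    change xi K n (fun _ => 1) (fun _ => 1) * z.1 * xi K n (fun _ => 1) (fun _ => 1) = _
    rw [← center_mul_comm z.2, mul_assoc, (xi_self_idem _).eq]⟩
  map_one' := Subtype.ext (one_mul _)
  map_mul' z w := Subtype.ext (by
    change z.1 * w.1 * xi K n (fun _ => 1) (fun _ => 1) =
      z.1 * xi K n (fun _ => 1) (fun _ => 1) * (w.1 * xi K n (fun _ => 1) (fun _ => 1))
    rw [mul_assoc z.1 (xi K n _ _), ← mul_assoc (xi K n _ _),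
      ← center_mul_comm w.2 (xi K n _ _), mul_assoc w.1, (xi_self_idem _).eq, mul_assoc])
  map_zero' := Subtype.ext (zero_mul _)
  map_add' z w := Subtype.ext (add_mul _ _ _)
  commutes' a := Subtype.ext (by
    rw [Algebra.algebraMap_eq_smul_one, Algebra.algebraMap_eq_smul_one]
    change a • (1 : Alg K n r) * xi K n (fun _ => 1) (fun _ => 1) =
      a • xi K n (fun _ => 1) (fun _ => 1)
    rw [smul_mul_assoc, one_mul])

theorem centerToCorner_bijective [NeZero n] [NeZero r] :
    Function.Bijective (centerToCorner K n r) := by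
  constructor
  · refine (injective_iff_map_eq_zero _).2 fun z hz => Subtype.ext ?_
    exact eq_zero_of_mem_center_of_mul_xi_one z.2 (congrArg Subtype.val hz)
  · intro x
    obtain ⟨hl, hr⟩ := (Subsemigroup.mem_corner_iff (xi_self_idem (K := K) (n := n) _)).1 x.2
    obtain ⟨p, N, h⟩ := exists_eq_polyToCenter_mul_pow x.1 hl hr
    exact ⟨_, Subtype.ext h.symm⟩

/-! ### Indecomposability -/

/-- A nontrivial ring whose center has no zero divisors is indecomposable. -/
theorem isIndecomposableRing_of_center (A : Type*) [Ring A] [Nontrivial A]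
    (h : ∀ z w : A, z ∈ Set.center A → z * w = 0 → w ∈ Set.center A → z = 0 ∨ w = 0) :
    IsIndecomposableRing A := by
  refine ⟨inferInstance, fun I J hIJ => ?_⟩
  have hdisj : ∀ x, x ∈ I → x ∈ J → x = 0 := fun x hI hJ => by
    have : x ∈ I ⊓ J := (TwoSidedIdeal.mem_inf A).2 ⟨hI, hJ⟩
    rw [hIJ.inf_eq_bot] at this
    exact (TwoSidedIdeal.mem_bot A).1 this
  have h1 : (1 : A) ∈ I ⊔ J := by rw [hIJ.sup_eq_top]; trivial
  obtain ⟨e, he, f, hf, hef⟩ := TwoSidedIdeal.mem_sup.1 h1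
  -- As `e + f = 1`, the commutator `e x - x e` equals `x f - f x`, so it lies in `I ∩ J = 0`.
  have hcomm : ∀ x, e * x = x * e := fun x => by
    refine sub_eq_zero.1 (hdisj _ (I.sub_mem (I.mul_mem_right _ _ he) (I.mul_mem_left _ _ he)) ?_)
    have : e * x - x * e = x * f - f * x := by
      rw [eq_sub_of_add_eq hef]
      noncomm_ring
    rw [this]
    exact J.sub_mem (J.mul_mem_left _ _ hf) (J.mul_mem_right _ _ hf)
  have hez : e ∈ Set.center A := Semigroup.mem_center_iff.2 fun x => (hcomm x).symm
  have hfz : f ∈ Set.center A := by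
    rw [← add_sub_cancel_left e f, hef]
    exact (Subring.center A).sub_mem (one_mem _) hez
  have hmul : e * f = 0 := hdisj _ (I.mul_mem_right _ _ he) (J.mul_mem_left _ _ hf)
  -- If one of `e`, `f` vanishes, the other is `1`; its ideal is then everything and the
  -- complementary ideal is zero.
  rcases h e f hez hmul hfz with h0 | h0
  · left
    rw [h0, zero_add] at hef
    refine eq_bot_iff.2 fun x hx => (TwoSidedIdeal.mem_bot A).2 (hdisj x hx ?_)
    have := J.mul_mem_left x f hf
    rwa [hef, mul_one] at this
  · right
    rw [h0, add_zero] at hef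
    refine eq_bot_iff.2 fun x hx => (TwoSidedIdeal.mem_bot A).2 (hdisj x ?_ hx)
    have := I.mul_mem_left x e he
    rwa [hef, mul_one] at this

theorem alg_isIndecomposableRing (K : Type u) [Field K] (n r : ℕ) [NeZero n] [NeZero r] :
    IsIndecomposableRing (Alg K n r) := by
  classical
  have : Nontrivial (Alg K n r) := ⟨1, 0, fun h => by
    have h' := congrArg (fun f => coeff f 0 0) h
    simp [coeff_one, coeff_zero] at h'⟩
  refine isIndecomposableRing_of_center _ fun z w hz hzw hw => ?_
  obtain ⟨φ, -, -⟩ := exists_polyLaurent_equiv_center K n r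
  have : IsDomain (PolyLaurent K r) := IsLocalization.isDomain_localization
    (powers_le_nonZeroDivisors_of_noZeroDivisors (X_ne_zero _))
  have : IsDomain (Subalgebra.center K (Alg K n r)) := φ.symm.toMulEquiv.isDomain _
  have h : (⟨z, hz⟩ * ⟨w, hw⟩ : Subalgebra.center K (Alg K n r)) = 0 := Subtype.ext hzw
  exact (mul_eq_zero.1 h).imp (congrArg Subtype.val) (congrArg Subtype.val)

end AffineSchur

theorem theoremT (K : Type u) [Field K] [Infinite K] (n r : ℕ) [NeZero n] [NeZero r] :
    -- `Z ≅ K[t_1, …, t_{r-1}, t_r, t_r⁻¹]`, with `t_k` corresponding to `c_{ε^k}`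
    (∃ φ : AffineSchur.PolyLaurent K r ≃ₐ[K] Subalgebra.center K (AffineSchur.Alg K n r),
      (∀ k : Fin r,
        (φ (algebraMap (MvPolynomial (Fin r) K) (AffineSchur.PolyLaurent K r)
          (MvPolynomial.X k)) : AffineSchur.Alg K n r) =
            AffineSchur.c K n (AffineSchur.eps r (k + 1))) ∧
      (φ (IsLocalization.Away.invSelf
          (MvPolynomial.X (Fin.rev 0) : MvPolynomial (Fin r) K)) : AffineSchur.Alg K n r) =
            AffineSchur.c K n (-AffineSchur.eps r r)) ∧
    -- `Z = K[c_{ε^1}, …, c_{ε^r}, c_{-ε^r}]`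
    Subalgebra.center K (AffineSchur.Alg K n r) =
      Algebra.adjoin K
        (Set.range (fun k : Fin r => AffineSchur.c K n (AffineSchur.eps r (k + 1))) ∪
          {AffineSchur.c K n (-AffineSchur.eps r r)}) ∧
    -- `Z ≅ S̃(1⋯1)`, through multiplication by `ξ_{1⋯1, 1⋯1}`
    (∃ ψ : Subalgebra.center K (AffineSchur.Alg K n r) ≃ₐ[K]
        AffineSchur.CentralizerAlg K n (fun _ : Fin r => (1 : ℤ)),
      ∀ z, ((ψ z).1 : AffineSchur.Alg K n r) =
        z.1 * AffineSchur.xi K n (fun _ : Fin r => (1 : ℤ)) (fun _ => 1)) ∧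
    -- `S̃(n, r)` is indecomposable
    AffineSchur.IsIndecomposableRing (AffineSchur.Alg K n r) := by
  refine ⟨?_, AffineSchur.center_eq_adjoin K n r,
    ⟨AlgEquiv.ofBijective _ AffineSchur.centerToCorner_bijective, fun _ => rfl⟩,
    AffineSchur.alg_isIndecomposableRing K n r⟩
  obtain ⟨φ, h1, h2⟩ := AffineSchur.exists_polyLaurent_equiv_center K n r
  refine ⟨φ, fun k => ?_, ?_⟩
  · rw [h1, AffineSchur.coe_polyToCenter_X]
  · rw [h2, AffineSchur.c_neg_eps_self]
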